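/- Throughout, $M=\{\rho\in L^\infty([0,1]) : 0\le\rho\le 1 \text{ a.e.}\}$. For real numbers $\varphi_0<\varphi_1$ put $\varepsilon_0=1/(\varphi_1-\varphi_0)$ and let $\mathcal F=\mathcal F(\varphi_0,\varphi_1)$ be the set of functions $\varphi:[0,1]\to\mathbb R$ of the form $\varphi(x)=\varphi_0+\mu([0,x])$, where $\mu$ is a positive Borel measure on $[0,1]$ with total mass $\varphi_1-\varphi_0$. For $\varepsilon\in(0,\varepsilon_0)$, $\rho\in M$ and $\varphi\in\mathcal F$ set $$(K_{\rho,\varepsilon}\varphi)(x)=\varphi_0+\frac1\varepsilon\int_0^x\frac{A\,\exp\big\{\frac1\varepsilon\int_0^y\big[(1+e^{\varphi(z)})^{-1}-\rho(z)\big]\,dz\big\}}{1+A\,\exp\big\{\frac1\varepsilon\int_0^y\big[(1+e^{\varphi(z)})^{-1}-\rho(z)\big]\,dz\big\}}\,dy,\qquad x\in[0,1],$$ where $A=A(\varepsilon,\rho,\varphi)\in(0,\infty)$ is the unique constant for which $(K_{\rho,\varepsilon}\varphi)(1)=\varphi_1$. Let $\mathscr P_\varepsilon(\rho)\subset\mathcal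 F$ be the set of fixed points of $K_{\rho,\varepsilon}$; its elements are called the critical points, or the solutions of the boundary value problem $$\frac{\varepsilon\varphi_{xx}}{\varphi_x(1-\varepsilon\varphi_x)}-\frac1{1+e^{\varphi}}+\rho=0,\qquad \varphi(0)=\varphi_0,\quad\varphi(1)=\varphi_1.$$ **Theorem 2.4.** The following statements hold. (i) Fix $\varphi_0<\varphi_1$. There exists $\varepsilon_1\in(0,\varepsilon_0)$ such that for any $\varepsilon\in(\varepsilon_1,\varepsilon_0)$ the set $\mathscr P_\varepsilon(\rho)$ is a singleton for any $\rho\in M$. (ii) Fix $\varepsilon>0$. There exists $\delta\in(0,\varepsilon^{-1})$ such that for any $\varphi_0,\varphi_1\in\mathbb R$ with $0<\varphi_1-\varphi_0<\delta$ the set $\mathscr P_\varepsilon(\rho)$ is a singleton for any $\rho\in M$. (iii) Fix $\varphi_0<\varphi_1$ and $\varepsilon\in(0,\varepsilon_0)$. If $\rho\in M$ is in $C^1([0,1])$ and strictly increasing, then the set $\mathscr P_\varepsilon(\rho)$ is a singleton. -/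

import Mathlib

open MeasureTheory Set
open scoped unitInterval ENNReal

noncomputable section

namespace BurgersStatic

/-- Lebesgue measure on `[0,1]`, seen as a measure on the real line. -/
abbrev lebUnit : Measure ℝ := volume.restrict (Icc (0 : ℝ) 1)

/-- The set `M` of (classes of) functions `ρ ∈ L^∞([0,1])` with `0 ≤ ρ ≤ 1`. -/
def M : Set (Lp ℝ ∞ lebUnit) :=
  {ρ | ∀ᵐ x ∂lebUnit, 0 ≤ ρ x ∧ ρ x ≤ 1}

/-- The set `𝓕` of functions `φ : [0,1] → ℝ` of the form `φ(x) = φ₀ + μ([0,x])`, where `μ` is a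
positive Borel measure on `[0,1]` of total mass `φ₁ - φ₀`. (In the type `I = [0,1]` the interval
`[0,x]` is `Iic x`.) -/
def F (φ₀ φ₁ : ℝ) : Set (I → ℝ) :=
  {φ | ∃ μ : Measure I, μ univ = ENNReal.ofReal (φ₁ - φ₀) ∧
    ∀ x : I, φ x = φ₀ + (μ (Iic x)).toReal}

/-- The threshold `ε₀ = 1 / (φ₁ - φ₀)`. -/
def eps0 (φ₀ φ₁ : ℝ) : ℝ := 1 / (φ₁ - φ₀)

/-- The function `y ↦ exp { ε⁻¹ ∫₀^y [(1 + e^φ)⁻¹ - ρ] dz }`. The function `φ` on `[0,1]` is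
extended to the line by constants only in order to be integrated; the values of the extension
outside `[0,1]` are not used for `y ∈ [0,1]`. -/
def weight (ε : ℝ) (ρ : Lp ℝ ∞ lebUnit) (φ : I → ℝ) (y : ℝ) : ℝ :=
  Real.exp (1 / ε * ∫ z in (0 : ℝ)..y,
    ((1 + Real.exp (IccExtend zero_le_one φ z))⁻¹ - ρ z))

/-- The right-hand side of the formula for `K_{ρ,ε} φ`, with the constant `A` left free. -/
def preK (ε φ₀ : ℝ) (ρ : Lp ℝ ∞ lebUnit) (φ : I → ℝ) (A : ℝ) (x : I) : ℝ :=
  φ₀ + 1 / ε * ∫ y in (0 : ℝ)..x, A * weight ε ρ φ y / (1 + A * weight ε ρ φ y)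

/-- `A ∈ (0,∞)` is such that `(K_{ρ,ε} φ)(1) = φ₁`. -/
def IsNormalizing (ε φ₀ φ₁ : ℝ) (ρ : Lp ℝ ∞ lebUnit) (φ : I → ℝ) (A : ℝ) : Prop :=
  0 < A ∧ preK ε φ₀ ρ φ A 1 = φ₁

/-- The constant `A = A(ε, ρ, φ)`: the normalizing constant, which exists and is unique for
`φ ∈ 𝓕` and `0 < ε < ε₀` by `existsUnique_isNormalizing` below. -/
def normConst (ε φ₀ φ₁ : ℝ) (ρ : Lp ℝ ∞ lebUnit) (φ : I → ℝ) : ℝ :=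
  Classical.epsilon (IsNormalizing ε φ₀ φ₁ ρ φ)

/-- The integral operator `K_{ρ,ε}`. -/
def K (ε φ₀ φ₁ : ℝ) (ρ : Lp ℝ ∞ lebUnit) (φ : I → ℝ) : I → ℝ :=
  preK ε φ₀ ρ φ (normConst ε φ₀ φ₁ ρ φ)

/-- The set `𝒫_ε(ρ)` of critical points: the fixed points of `K_{ρ,ε}` in `𝓕`. -/
def P (ε φ₀ φ₁ : ℝ) (ρ : Lp ℝ ∞ lebUnit) : Set (I → ℝ) :=
  {φ | φ ∈ F φ₀ φ₁ ∧ K ε φ₀ φ₁ ρ φ = φ}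

/-- `ρ ∈ L^∞([0,1])` is (has a representative which is) `C¹` and strictly increasing on `[0,1]`. -/
def IsC1StrictIncreasing (ρ : Lp ℝ ∞ lebUnit) : Prop :=
  ∃ r : ℝ → ℝ, ContDiffOn ℝ 1 r (Icc 0 1) ∧ StrictMonoOn r (Icc 0 1) ∧ ρ =ᵐ[lebUnit] r

lemma existsUnique_const {w : ℝ → ℝ} (hw : ContinuousOn w (Icc 0 1))
    (hpos : ∀ y ∈ Icc (0 : ℝ) 1, 0 < w y) {c : ℝ} (hc0 : 0 < c) (hc1 : c < 1) :
    ∃! A : ℝ, 0 < A ∧ ∫ y in (0 : ℝ)..1, A * w y / (1 + A * w y) = c := by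
  have hcont : ∀ A : ℝ, 0 < A → ContinuousOn (fun y => A * w y / (1 + A * w y)) (Icc 0 1) := by
    intro A hA
    refine ContinuousOn.div (by fun_prop) (by fun_prop) ?_
    intro y hy
    have := mul_pos hA (hpos y hy)
    positivity
  have hint : ∀ A : ℝ, 0 < A → IntervalIntegrable (fun y => A * w y / (1 + A * w y))
      volume 0 1 := fun A hA =>
    ContinuousOn.intervalIntegrable (by rw [uIcc_of_le zero_le_one]; exact hcont A hA)
  have hmono : ∀ a b s : ℝ, 0 < a → 0 < s → a < b →
      a * s / (1 + a * s) < b * s / (1 + b * s) := by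
    intro a b s ha hs hab
    have h1 := mul_pos ha hs
    have h2 := mul_pos (ha.trans hab) hs
    rw [div_lt_div_iff₀ (by positivity) (by positivity)]
    nlinarith [mul_lt_mul_of_pos_right hab hs]
  have hstrict : ∀ a b : ℝ, 0 < a → a < b →
      ∫ y in (0 : ℝ)..1, a * w y / (1 + a * w y) < ∫ y in (0 : ℝ)..1, b * w y / (1 + b * w y) := by
    intro a b ha hab
    refine intervalIntegral.integral_lt_integral_of_continuousOn_of_le_of_exists_lt one_pos
      (hcont a ha) (hcont b (ha.trans hab)) ?_ ⟨0, by simp, ?_⟩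
    · intro y hy
      exact (hmono a b _ ha (hpos y (Ioc_subset_Icc_self hy)) hab).le
    · exact hmono a b _ ha (hpos 0 (by simp)) hab
  obtain ⟨y0, hy0, hmin⟩ := isCompact_Icc.exists_isMinOn (nonempty_Icc.2 zero_le_one) hw
  obtain ⟨y1, hy1, hmax⟩ := isCompact_Icc.exists_isMaxOn (nonempty_Icc.2 zero_le_one) hw
  have hm := hpos y0 hy0
  have hM := hpos y1 hy1
  have hc : 0 < 1 - c := by linarith
  set q := c / (1 - c) with hq
  have hq0 : 0 < q := by positivity
  have hqc : q * (1 - c) = c := by rw [hq]; field_simp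
  have hlow : ∫ y in (0 : ℝ)..1, (q / w y1) * w y / (1 + (q / w y1) * w y) ≤ c := by
    have h : ∫ _ in (0 : ℝ)..1, c = c := by simp
    rw [← h]
    refine intervalIntegral.integral_mono_on zero_le_one (hint _ (by positivity)) (by simp) ?_
    intro y hy
    have hy' := hpos y hy
    have hle : w y ≤ w y1 := hmax hy
    have h2 : q / w y1 * w y ≤ q := by
      rw [div_mul_eq_mul_div, div_le_iff₀ hM]
      exact mul_le_mul_of_nonneg_left hle hq0.le
    rw [div_le_iff₀ (by positivity)]
    nlinarith
  have hhigh : c ≤ ∫ y in (0 : ℝ)..1, (q / w y0) * w y / (1 + (q / w y0) * w y) := by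
    have h : ∫ _ in (0 : ℝ)..1, c = c := by simp
    nth_rewrite 1 [← h]
    refine intervalIntegral.integral_mono_on zero_le_one (by simp) (hint _ (by positivity)) ?_
    intro y hy
    have hy' := hpos y hy
    have hle : w y0 ≤ w y := hmin hy
    have h2 : q ≤ q / w y0 * w y := by
      rw [div_mul_eq_mul_div, le_div_iff₀ hm]
      exact mul_le_mul_of_nonneg_left hle hq0.le
    rw [le_div_iff₀ (by positivity)]
    nlinarith
  have hab : q / w y1 ≤ q / w y0 := by
    have hle : w y0 ≤ w y1 := hmin hy1
    gcongr
  have hparam : ContinuousOn (fun A : ℝ => ∫ y in (0 : ℝ)..1, A * w y / (1 + A * w y))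
      (Icc (q / w y1) (q / w y0)) := by
    intro A hA
    have hpA : ∀ B ∈ Icc (q / w y1) (q / w y0), 0 < B := fun B hB =>
      lt_of_lt_of_le (by positivity) hB.1
    refine intervalIntegral.continuousWithinAt_of_dominated_interval (bound := fun _ => 1)
      ?_ ?_ (by simp) ?_
    · filter_upwards [self_mem_nhdsWithin] with B hB
      exact (hint B (hpA B hB)).def'.aestronglyMeasurable
    · filter_upwards [self_mem_nhdsWithin] with B hB
      refine Filter.Eventually.of_forall fun y hy => ?_
      rw [uIoc_of_le zero_le_one] at hy
      have h3 := mul_pos (hpA B hB) (hpos y (Ioc_subset_Icc_self hy))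
      rw [Real.norm_of_nonneg (by positivity), div_le_one (by positivity)]
      linarith
    · refine Filter.Eventually.of_forall fun y hy => ?_
      rw [uIoc_of_le zero_le_one] at hy
      have h3 := mul_pos (hpA A hA) (hpos y (Ioc_subset_Icc_self hy))
      exact ContinuousWithinAt.div (by fun_prop) (by fun_prop) (by positivity)
  obtain ⟨A, hA, hAc⟩ := intermediate_value_Icc hab hparam ⟨hlow, hhigh⟩
  have hApos : 0 < A := lt_of_lt_of_le (by positivity) hA.1
  refine ⟨A, ⟨hApos, hAc⟩, ?_⟩
  rintro B ⟨hB, hBc⟩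
  simp only at hAc
  rcases lt_trichotomy A B with h | h | h
  · have := hstrict A B hApos h; linarith
  · exact h.symm
  · have := hstrict B A hB h; linarith

lemma F_monotone {φ₀ φ₁ : ℝ} {φ : I → ℝ} (hφ : φ ∈ F φ₀ φ₁) : Monotone φ := by
  obtain ⟨μ, hμ, h⟩ := hφ
  intro x y hxy
  have : IsFiniteMeasure μ := ⟨by rw [hμ]; exact ENNReal.ofReal_lt_top⟩
  rw [h, h]
  have := ENNReal.toReal_mono (measure_ne_top μ _) (measure_mono (Iic_subset_Iic.2 hxy))
  linarith

/-- The operator `K_{ρ,ε}` is well defined: the normalizing constant exists and is unique. -/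
theorem existsUnique_isNormalizing {ε φ₀ φ₁ : ℝ} (hφ : φ₀ < φ₁) (hε : 0 < ε)
    (hε₀ : ε < eps0 φ₀ φ₁) (ρ : Lp ℝ ∞ lebUnit) {φ : I → ℝ} (h : φ ∈ F φ₀ φ₁) :
    ∃! A : ℝ, IsNormalizing ε φ₀ φ₁ ρ φ A := by
  have hd : 0 < φ₁ - φ₀ := by linarith
  have hρ : IntegrableOn (fun z => ρ z) (Icc 0 1) volume :=
    (Lp.memLp ρ).integrable le_top
  have hmon : Monotone (IccExtend (zero_le_one (α := ℝ)) φ) := (F_monotone h).IccExtend _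
  have hmeas : Measurable fun z : ℝ => (1 + Real.exp (IccExtend zero_le_one φ z))⁻¹ :=
    (measurable_const.add (Real.measurable_exp.comp hmon.measurable)).inv
  have hb : IntegrableOn (fun z : ℝ => (1 + Real.exp (IccExtend zero_le_one φ z))⁻¹)
      (Icc 0 1) volume := by
    refine Measure.integrableOn_of_bounded (M := 1) (by simp) hmeas.aestronglyMeasurable ?_
    refine Filter.Eventually.of_forall fun z => ?_
    have := Real.exp_pos (IccExtend zero_le_one φ z)
    rw [Real.norm_of_nonneg (by positivity)]
    exact inv_le_one_of_one_le₀ (by linarith)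
  have hw : ContinuousOn (weight ε ρ φ) (Icc 0 1) := by
    have hc := intervalIntegral.continuousOn_primitive_interval (a := (0 : ℝ)) (b := 1)
      (f := fun z => (1 + Real.exp (IccExtend zero_le_one φ z))⁻¹ - ρ z) (μ := volume)
      (by rw [uIcc_of_le zero_le_one]; exact hb.sub hρ)
    rw [uIcc_of_le zero_le_one] at hc
    exact Real.continuous_exp.comp_continuousOn (continuousOn_const.mul hc)
  have hc1 : ε * (φ₁ - φ₀) < 1 := by
    rw [eps0, lt_div_iff₀ hd] at hε₀
    exact hε₀
  have key := existsUnique_const hw (fun y _ => Real.exp_pos _) (mul_pos hε hd) hc1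
  refine (existsUnique_congr fun A => ?_).mp key
  unfold IsNormalizing preK
  refine and_congr_right fun _ => ?_
  simp only [Icc.coe_one]
  constructor
  · intro e
    rw [e]; field_simp; ring
  · intro e
    rw [← e]; field_simp; ring

end BurgersStatic

end

noncomputable section

namespace BurgersStatic

open Real (sigmoid)
open Filter Topology

/-! Write `σ` for the sigmoid and put `s = log A + ε⁻¹ ∫₀ˣ (σ(-φ) - ρ)`. The fixed point equation
becomes the first order system `ε φ' = σ(s)`, `ε s' = σ(-φ) - ρ`, with `φ` prescribed at 0 and 1 and
`s 0 = log A` free. The two formulations are matched by `exists_isTrajectory_of_mem_P` and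
`IsTrajectory.mem_P`.

Existence is by shooting in `s 0`: `f 1` depends continuously on it, and a very negative or very
large `s 0` puts `f 1` below or above the target (`exists_isTrajectory_boundary`).

Uniqueness in (i) and (ii) is a contraction estimate (`eqOn_of_integral_lt`). If two solutions
differ by at most `E`, Rolle gives a point where their `s` agree, so the `s` differ by at most
`E/ε`. Integrating back gives `E ≤ ε⁻² E ∫ c`, where `c` bounds the difference quotient of `σ`. That
quotient is small where `σ` is near 0 or near 1, and `∫ σ(s) = ε(φ₁ - φ₀)` is fixed by the boundary
values, so `∫ c` is small both for small `φ₁ - φ₀` and for `ε` near `ε₀`.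

Uniqueness in (iii) rests on an energy. With `G(x) = log(1 + eˣ)`, along a solution the derivative
of `G(s) + G(-f) + ρ f` is `ρ' f`. Comparing two solutions up to their first return to the same
height shows that the one that left upwards also arrives with the larger slope, which is impossible
(`fst_one_ne`). -/

/-! ### Difference quotients of the sigmoid -/

/-- The difference equals `σ(t) (1 - σ(s)) (1 - e^{-(t-s)})`, and `1 - e^{-u} ≤ u` for every real
`u`. -/
lemma sigmoid_sub_le (s t : ℝ) :
    sigmoid t - sigmoid s ≤ sigmoid t * (1 - sigmoid s) * (t - s) := by
  have h1 : (1 + Real.exp (-t)) * sigmoid t = 1 :=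
    mul_inv_cancel₀ (by positivity)
  have h2 : (1 + Real.exp (-s)) * sigmoid s = 1 :=
    mul_inv_cancel₀ (by positivity)
  have h3 : sigmoid s * Real.exp (-s) = 1 - sigmoid s := by
    rw [Real.sigmoid_mul_rexp_neg, Real.sigmoid_neg]
  have h4 : Real.exp (-t) = Real.exp (-s) * Real.exp (-(t - s)) := by
    rw [← Real.exp_add]; ring_nf
  have h5 : 1 - Real.exp (-(t - s)) ≤ t - s := by
    linarith [Real.add_one_le_exp (-(t - s))]
  have h6 : sigmoid t - sigmoid s
      = sigmoid t * (sigmoid s * Real.exp (-s)) * (1 - Real.exp (-(t - s))) := by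
    have : sigmoid t - sigmoid s = sigmoid t * sigmoid s * (Real.exp (-s) - Real.exp (-t)) := by
      linear_combination -sigmoid t * h2 + sigmoid s * h1
    rw [this, h4]; ring
  rw [h6, h3]
  have := Real.sigmoid_pos t
  have := Real.sigmoid_lt_one s
  exact mul_le_mul_of_nonneg_left h5 (mul_nonneg (by linarith) (by linarith))

/-- One factor of `σ(s) (1 - σ(t))` is dropped in each bound. Both resulting weights have an
integral along a trajectory that the boundary values determine; the first serves (ii), the second
(i). -/
lemma abs_sigmoid_sub_le (s t : ℝ) :
    |sigmoid s - sigmoid t| ≤ |s - t| * (sigmoid s + sigmoid t) ∧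
    |sigmoid s - sigmoid t| ≤ |s - t| * (2 - sigmoid s - sigmoid t) := by
  wlog h : t ≤ s generalizing s t
  · obtain ⟨h1, h2⟩ := this t s (le_of_not_ge h)
    rw [abs_sub_comm s, abs_sub_comm (sigmoid s)]
    exact ⟨by linarith, by linarith⟩
  have hm := Real.sigmoid_monotone h
  have h1 := sigmoid_sub_le t s
  have := Real.sigmoid_pos t
  have := Real.sigmoid_pos s
  have := Real.sigmoid_lt_one t
  have := Real.sigmoid_lt_one s
  have hd : 0 ≤ s - t := by linarith
  rw [abs_of_nonneg hd, abs_of_nonneg (by linarith)]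
  constructor
  · refine h1.trans ?_
    rw [mul_comm]
    exact mul_le_mul_of_nonneg_left (by nlinarith) hd
  · refine h1.trans ?_
    rw [mul_comm]
    exact mul_le_mul_of_nonneg_left (by nlinarith) hd

lemma abs_sigmoid_sub_le_abs_sub (s t : ℝ) : |sigmoid s - sigmoid t| ≤ |s - t| := by
  obtain ⟨h1, h2⟩ := abs_sigmoid_sub_le s t
  linarith

/-! ### Trajectories and uniqueness by contraction -/

/-- A trajectory on `[0,1]` of the first order system `ε f' = σ(s)`, `ε (s + R)' = σ(-f)`
in integrated form, where `σ` is the sigmoid function. -/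
structure IsTrajectory (ε : ℝ) (R f s : ℝ → ℝ) : Prop where
  continuous_fst : Continuous f
  continuous_snd : Continuous s
  fst_eq : ∀ t ∈ Icc (0 : ℝ) 1, f t = f 0 + 1 / ε * ∫ y in (0 : ℝ)..t, sigmoid (s y)
  snd_eq : ∀ t ∈ Icc (0 : ℝ) 1,
    s t = s 0 + 1 / ε * (∫ y in (0 : ℝ)..t, sigmoid (-f y)) - R t

lemma hasDerivAt_add_mul_integral {g : ℝ → ℝ} (hg : Continuous g) (a c t : ℝ) :
    HasDerivAt (fun x => a + c * ∫ y in (0 : ℝ)..x, g y) (c * g t) t :=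
  ((intervalIntegral.integral_hasDerivAt_right (hg.intervalIntegrable _ _)
    hg.aestronglyMeasurable.stronglyMeasurableAtFilter hg.continuousAt).const_mul c).const_add a

namespace IsTrajectory

variable {ε : ℝ} {R f s g r : ℝ → ℝ}

lemma continuous_sigmoid_snd (h : IsTrajectory ε R f s) : Continuous fun y => sigmoid (s y) :=
  continuous_sigmoid.comp h.continuous_snd

lemma continuous_sigmoid_neg_fst (h : IsTrajectory ε R f s) :
    Continuous fun y => sigmoid (-f y) :=
  continuous_sigmoid.comp h.continuous_fst.neg

lemma hasDerivAt_fst (h : IsTrajectory ε R f s) {t : ℝ} (ht : t ∈ Ioo (0 : ℝ) 1) :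
    HasDerivAt f (1 / ε * sigmoid (s t)) t := by
  refine (hasDerivAt_add_mul_integral h.continuous_sigmoid_snd (f 0) (1 / ε) t).congr_of_eventuallyEq
    ?_
  filter_upwards [Icc_mem_nhds ht.1 ht.2] with x hx using h.fst_eq x hx

lemma hasDerivAt_snd (h : IsTrajectory ε R f s) {t R' : ℝ} (ht : t ∈ Ioo (0 : ℝ) 1)
    (hR : HasDerivAt R R' t) : HasDerivAt s (1 / ε * sigmoid (-f t) - R') t := by
  refine ((hasDerivAt_add_mul_integral h.continuous_sigmoid_neg_fst (s 0) (1 / ε) t).sub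
    hR).congr_of_eventuallyEq ?_
  filter_upwards [Icc_mem_nhds ht.1 ht.2] with x hx using h.snd_eq x hx

/-- Two trajectories with the same boundary values of the first component coincide under a
smallness condition. -/
lemma eqOn_of_integral_lt (hf : IsTrajectory ε R f s) (hg : IsTrajectory ε R g r)
    (hε : 0 < ε) (h0 : f 0 = g 0) (h1 : f 1 = g 1) {c : ℝ → ℝ} (hc : Continuous c)
    (hle : ∀ t, |sigmoid (s t) - sigmoid (r t)| ≤ |s t - r t| * c t)
    (hc0 : ∀ t, 0 ≤ c t) (hlt : ∫ t in (0 : ℝ)..1, c t < ε ^ 2) :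
    EqOn f g (Icc 0 1) := by
  obtain ⟨m, hm, hmax⟩ := isCompact_Icc.exists_isMaxOn (nonempty_Icc.2 (zero_le_one (α := ℝ)))
    ((hf.continuous_fst.sub hg.continuous_fst).abs.continuousOn)
  set E := |f m - g m| with hE
  have hmax' : ∀ t ∈ Icc (0 : ℝ) 1, |f t - g t| ≤ E := fun t ht => hmax ht
  -- Rolle for `f - g`: at `τ` the slopes agree, hence so do `s` and `r`, and `s - r` can be
  -- integrated from `τ`. The forcing `R` cancels in the difference.
  obtain ⟨τ, hτ, hτ0⟩ := exists_hasDerivAt_eq_zero (f := fun t => f t - g t) one_pos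
    (hf.continuous_fst.sub hg.continuous_fst).continuousOn (by simp only [h0, h1, sub_self])
    (fun t ht => (hf.hasDerivAt_fst ht).sub (hg.hasDerivAt_fst ht))
  have hτe : s τ = r τ := by
    rw [← mul_sub, mul_eq_zero_iff_left (by positivity), sub_eq_zero] at hτ0
    exact Real.sigmoid_injective hτ0
  have hτ' : τ ∈ Icc (0 : ℝ) 1 := Ioo_subset_Icc_self hτ
  have hsub : ∀ t ∈ Icc (0 : ℝ) 1, |s t - r t| ≤ 1 / ε * E := by
    intro t ht
    have e : s t - r t = 1 / ε * ∫ y in τ..t, (sigmoid (-f y) - sigmoid (-g y)) := by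
      have e1 := hf.snd_eq t ht
      have e2 := hg.snd_eq t ht
      have e3 := hf.snd_eq τ hτ'
      have e4 := hg.snd_eq τ hτ'
      have hi1 := fun a b => hf.continuous_sigmoid_neg_fst.intervalIntegrable (μ := volume) a b
      have hi2 := fun a b => hg.continuous_sigmoid_neg_fst.intervalIntegrable (μ := volume) a b
      rw [intervalIntegral.integral_sub (hi1 _ _) (hi2 _ _),
        ← intervalIntegral.integral_interval_sub_left (hi1 0 t) (hi1 0 τ),
        ← intervalIntegral.integral_interval_sub_left (hi2 0 t) (hi2 0 τ)]
      linear_combination e1 - e2 - e3 + e4 + hτe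
    have hb : ‖∫ y in τ..t, (sigmoid (-f y) - sigmoid (-g y))‖ ≤ E * |t - τ| := by
      refine intervalIntegral.norm_integral_le_of_norm_le_const fun y hy => ?_
      have hy' : y ∈ Icc (0 : ℝ) 1 := by
        have := uIoc_subset_uIcc hy
        exact uIcc_subset_Icc hτ' ht this
      refine (abs_sigmoid_sub_le_abs_sub _ _).trans ?_
      have : -f y - -g y = -(f y - g y) := by ring
      rw [this, abs_neg]
      exact hmax' y hy'
    have hE0 : 0 ≤ E := abs_nonneg _
    have ht1 : |t - τ| ≤ 1 := by
      rw [abs_le]; constructor <;> linarith [ht.1, ht.2, hτ'.1, hτ'.2]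
    rw [e, abs_mul, abs_of_nonneg (by positivity : 0 ≤ 1 / ε)]
    rw [Real.norm_eq_abs] at hb
    refine mul_le_mul_of_nonneg_left (hb.trans ?_) (by positivity)
    nlinarith
  -- The estimate closes on itself at the maximum point `m`; since `∫ c < ε²`, it forces `E = 0`.
  have hEE : E ≤ 1 / ε * (1 / ε * E * ∫ t in (0 : ℝ)..1, c t) := by
    have e : f m - g m = 1 / ε * ∫ y in (0 : ℝ)..m, (sigmoid (s y) - sigmoid (r y)) := by
      rw [intervalIntegral.integral_sub (hf.continuous_sigmoid_snd.intervalIntegrable _ _)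
        (hg.continuous_sigmoid_snd.intervalIntegrable _ _)]
      linear_combination hf.fst_eq m hm - hg.fst_eq m hm + h0
    have e' : E = 1 / ε * |∫ y in (0 : ℝ)..m, (sigmoid (s y) - sigmoid (r y))| := by
      rw [hE, e, abs_mul, abs_of_nonneg (by positivity : 0 ≤ 1 / ε)]
    refine e'.le.trans ?_
    refine mul_le_mul_of_nonneg_left ?_ (by positivity)
    have hE0 : 0 ≤ E := abs_nonneg _
    have hci : Continuous fun y => 1 / ε * E * c y := by fun_prop
    calc |∫ y in (0 : ℝ)..m, (sigmoid (s y) - sigmoid (r y))|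
        ≤ ∫ y in (0 : ℝ)..m, 1 / ε * E * c y := by
          rw [← Real.norm_eq_abs]
          refine intervalIntegral.norm_integral_le_of_norm_le hm.1 ?_
            (hci.intervalIntegrable _ _)
          refine Eventually.of_forall fun y hy => (hle y).trans ?_
          exact mul_le_mul_of_nonneg_right (hsub y ⟨hy.1.le, hy.2.trans hm.2⟩) (hc0 y)
      _ ≤ ∫ y in (0 : ℝ)..1, 1 / ε * E * c y := by
          refine intervalIntegral.integral_mono_interval le_rfl hm.1 hm.2 ?_
            (hci.intervalIntegrable _ _)
          exact Eventually.of_forall fun y => mul_nonneg (by positivity) (hc0 y)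
      _ = _ := intervalIntegral.integral_const_mul _ _
  have hE0 : E ≤ 0 := by
    by_contra! hpos
    have : 1 / ε * (1 / ε * E * ∫ t in (0 : ℝ)..1, c t) < E := by
      have : 1 / ε * (1 / ε * E * ∫ t in (0 : ℝ)..1, c t)
        = E * ((∫ t in (0 : ℝ)..1, c t) / ε ^ 2) := by field_simp
      rw [this]
      have : (∫ t in (0 : ℝ)..1, c t) / ε ^ 2 < 1 := by
        rwa [div_lt_one (by positivity)]
      nlinarith
    linarith
  intro t ht
  have := abs_nonpos_iff.1 ((hmax' t ht).trans hE0)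
  linarith

lemma strictMonoOn_sub (hf : IsTrajectory ε R f s) (hg : IsTrajectory ε R g r) (hε : 0 < ε)
    {a b : ℝ} (ha : 0 ≤ a) (hb : b ≤ 1) (h : ∀ t ∈ Ioo a b, r t < s t) :
    StrictMonoOn (fun t => f t - g t) (Icc a b) := by
  refine strictMonoOn_of_deriv_pos (convex_Icc a b)
    (hf.continuous_fst.sub hg.continuous_fst).continuousOn fun t ht => ?_
  rw [interior_Icc] at ht
  have ht' : t ∈ Ioo (0 : ℝ) 1 := ⟨ha.trans_lt ht.1, ht.2.trans_le hb⟩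
  have hd : deriv (fun t => f t - g t) t = 1 / ε * sigmoid (s t) - 1 / ε * sigmoid (r t) :=
    ((hf.hasDerivAt_fst ht').sub (hg.hasDerivAt_fst ht')).deriv
  rw [hd, ← mul_sub]
  exact mul_pos (by positivity) (sub_pos.2 (Real.sigmoid_strictMono (h t ht)))

end IsTrajectory

/-! ### Energy comparison for monotone forcing -/

lemma hasDerivAt_log_one_add_exp (x : ℝ) :
    HasDerivAt (fun x => Real.log (1 + Real.exp x)) (sigmoid x) x := by
  have h : (1 : ℝ) + Real.exp x ≠ 0 := by positivity
  convert ((Real.hasDerivAt_exp x).const_add 1).log h using 1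
  rw [Real.sigmoid_def, Real.exp_neg]
  field_simp
  ring

lemma strictMono_log_one_add_exp : StrictMono fun x => Real.log (1 + Real.exp x) :=
  fun _ _ h => Real.log_lt_log (by positivity) (by gcongr)

namespace IsTrajectory

variable {ε : ℝ} {R f s g r : ℝ → ℝ}

/-- For a nondecreasing forcing, trajectories starting at the same height do not meet again. -/
lemma fst_one_ne (hf : IsTrajectory ε R f s) (hg : IsTrajectory ε R g r)
    (hε : 0 < ε) {w w' : ℝ → ℝ} (hw : ContinuousOn w (Icc 0 1))
    (hR : ∀ t ∈ Ioo (0 : ℝ) 1, HasDerivAt R (1 / ε * w t) t)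
    (hw' : ∀ t ∈ Ioo (0 : ℝ) 1, HasDerivAt w (w' t) t) (hw0 : ∀ t ∈ Ioo (0 : ℝ) 1, 0 ≤ w' t)
    (h0 : f 0 = g 0) (hs : r 0 < s 0) : f 1 ≠ g 1 := by
  intro h1
  have hcont : Continuous fun t => f t - g t := hf.continuous_fst.sub hg.continuous_fst
  have hev : ∀ {t : ℝ}, r t < s t → ∃ d > 0, ∀ x, |x - t| < d → r x < s x := by
    intro t ht
    have := (isOpen_lt hg.continuous_snd hf.continuous_snd).mem_nhds ht
    obtain ⟨d, hd, hsub⟩ := Metric.mem_nhds_iff.1 this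
    exact ⟨d, hd, fun x hx => hsub (by simpa [Real.dist_eq] using hx)⟩
  obtain ⟨d, hd, hds⟩ := hev hs
  set δ := min d 1 with hδ
  have hδ0 : 0 < δ := lt_min hd one_pos
  have hinc : StrictMonoOn (fun t => f t - g t) (Icc 0 δ) :=
    hf.strictMonoOn_sub hg hε le_rfl (min_le_right _ _) fun t ht =>
      hds t (by rw [sub_zero, abs_of_pos ht.1]; exact ht.2.trans_le (min_le_left _ _))
  have hpos : ∀ t ∈ Ioc 0 δ, 0 < f t - g t := by
    intro t ht
    have := hinc ⟨le_rfl, hδ0.le⟩ ⟨ht.1.le, ht.2⟩ ht.1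
    simpa [h0] using this
  -- `t₁` is the first return of `f - g` to zero; searching on `[δ, 1]` excludes the trivial zero at
  -- 0.
  obtain ⟨t₁, ⟨ht₁, hle⟩, hleast⟩ :=
    (isCompact_Icc.inter_right (isClosed_le hcont continuous_const) :
      IsCompact (Icc δ 1 ∩ {t | f t - g t ≤ 0})).exists_isLeast
      ⟨1, ⟨min_le_right _ _, le_rfl⟩, by simp [h1]⟩
  have ht₁0 : 0 < t₁ := hδ0.trans_le ht₁.1
  have hpos' : ∀ t ∈ Ioo 0 t₁, 0 < f t - g t := by
    intro t ht
    rcases le_or_gt t δ with h | h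
    · exact hpos t ⟨ht.1, h⟩
    · by_contra! hn
      exact absurd (hleast ⟨⟨h.le, ht.2.le.trans ht₁.2⟩, hn⟩) (not_le.2 ht.2)
  have hzero : f t₁ - g t₁ = 0 := by
    refine le_antisymm hle ?_
    have hsub : closure (Ioo 0 t₁) ⊆ {t | 0 ≤ f t - g t} :=
      closure_minimal (fun t ht => (hpos' t ht).le) (isClosed_le continuous_const hcont)
    rw [closure_Ioo ht₁0.ne] at hsub
    exact hsub ⟨ht₁0.le, le_rfl⟩
  set G : ℝ → ℝ := fun x => Real.log (1 + Real.exp x) with hG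
  have hGc : Continuous G :=
    continuous_iff_continuousAt.2 fun x => (hasDerivAt_log_one_add_exp x).continuousAt
  -- In the derivative of the energy difference the products of sigmoids and the terms in `w`
  -- cancel, leaving `w' (f - g)`, which is nonnegative before `t₁`.
  have hmono : MonotoneOn (fun t => G (s t) - G (r t) + (G (-f t) - G (-g t))
      + w t * (f t - g t)) (Icc 0 t₁) := by
    have hD : ∀ t ∈ Ioo 0 t₁, HasDerivAt (fun t => G (s t) - G (r t) + (G (-f t) - G (-g t))
      + w t * (f t - g t)) (w' t * (f t - g t)) t := by
      intro t ht
      have ht' : t ∈ Ioo (0 : ℝ) 1 := ⟨ht.1, ht.2.trans_le ht₁.2⟩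
      have d1 := hf.hasDerivAt_fst ht'
      have d2 := hg.hasDerivAt_fst ht'
      have d3 := (hasDerivAt_log_one_add_exp _).comp t (hf.hasDerivAt_snd ht' (hR t ht'))
      have d4 := (hasDerivAt_log_one_add_exp _).comp t (hg.hasDerivAt_snd ht' (hR t ht'))
      have d5 := (hasDerivAt_log_one_add_exp _).comp t d1.neg
      have d6 := (hasDerivAt_log_one_add_exp _).comp t d2.neg
      refine (((d3.sub d4).add (d5.sub d6)).add ((hw' t ht').mul (d1.sub d2))).congr_deriv ?_
      simp only [Pi.neg_apply, Pi.sub_apply]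
      ring
    refine monotoneOn_of_deriv_nonneg (convex_Icc _ _) ?_ ?_ ?_
    · refine ContinuousOn.add (Continuous.continuousOn ?_)
        ((hw.mono (Icc_subset_Icc_right ht₁.2)).mul hcont.continuousOn)
      exact ((hGc.comp hf.continuous_snd).sub (hGc.comp hg.continuous_snd)).add
        ((hGc.comp hf.continuous_fst.neg).sub (hGc.comp hg.continuous_fst.neg))
    · rw [interior_Icc]
      exact fun t ht => (hD t ht).differentiableAt.differentiableWithinAt
    · rw [interior_Icc]
      intro t ht
      rw [(hD t ht).deriv]
      exact mul_nonneg (hw0 t ⟨ht.1, ht.2.trans_le ht₁.2⟩) (hpos' t ht).le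
  -- At 0 and at `t₁` the heights agree, so the energy difference reduces to `G(s) - G(r)`, and its
  -- sign at 0 persists.
  have hend : r t₁ < s t₁ := by
    have h2 := hmono ⟨le_rfl, ht₁0.le⟩ ⟨ht₁0.le, le_rfl⟩ ht₁0.le
    have h3 : f t₁ = g t₁ := by linarith
    simp only [h0, h3, sub_self, mul_zero, add_zero] at h2
    have h4 : G (r 0) < G (s 0) := strictMono_log_one_add_exp hs
    exact strictMono_log_one_add_exp.lt_iff_lt.1 (show G (r t₁) < G (s t₁) by linarith)
  obtain ⟨e, he, hes⟩ := hev hend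
  -- On `[a, t₁]` the difference `f - g` increases strictly to 0, yet it is positive at `a`.
  set a := max (t₁ / 2) (t₁ - e / 2) with ha
  have ha1 : a < t₁ := max_lt (by linarith) (by linarith)
  have ha0 : 0 < a := lt_max_of_lt_left (by linarith)
  have hinc' : StrictMonoOn (fun t => f t - g t) (Icc a t₁) :=
    hf.strictMonoOn_sub hg hε ha0.le ht₁.2 fun t ht => hes t (by
      have := le_max_right (t₁ / 2) (t₁ - e / 2)
      rw [abs_lt]; constructor <;> linarith [ht.1, ht.2])
  have h5 := hinc' ⟨le_rfl, ha1.le⟩ ⟨ha1.le, le_rfl⟩ ha1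
  have h6 := hpos' a ⟨ha0, ha1⟩
  simp only at h5
  linarith

end IsTrajectory

/-! ### Initial value problem and shooting -/

/-- The time-dependent vector field on the plane whose integral curves are `t ↦ (f t, s t + R t)`
for the trajectories `(f, s)`. -/
def planeField (ε : ℝ) (R : ℝ → ℝ) (t : ℝ) (p : ℝ × ℝ) : ℝ × ℝ :=
  (1 / ε * sigmoid (p.2 - R t), 1 / ε * sigmoid (-p.1))

lemma lipschitzWith_planeField {ε : ℝ} (hε : 0 < ε) (R : ℝ → ℝ) (t : ℝ) :
    LipschitzWith (Real.toNNReal (1 / ε)) (planeField ε R t) := by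
  refine LipschitzWith.of_dist_le_mul fun p q => ?_
  have he : 0 ≤ 1 / ε := by positivity
  rw [Real.coe_toNNReal _ he, Prod.dist_eq, Prod.dist_eq, mul_max_of_nonneg _ _ he]
  simp only [planeField, Real.dist_eq, ← mul_sub, abs_mul, abs_of_nonneg he]
  -- Each component of the field depends on the other coordinate.
  rw [max_comm]
  refine max_le_max (mul_le_mul_of_nonneg_left ?_ he) (mul_le_mul_of_nonneg_left ?_ he)
  · refine (abs_sigmoid_sub_le_abs_sub _ _).trans_eq ?_
    rw [← abs_neg]; ring_nf
  · refine (abs_sigmoid_sub_le_abs_sub _ _).trans_eq ?_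
    ring_nf

lemma norm_planeField_le {ε : ℝ} (hε : 0 < ε) (R : ℝ → ℝ) (t : ℝ) (p : ℝ × ℝ) :
    ‖planeField ε R t p‖ ≤ 1 / ε := by
  have he : 0 ≤ 1 / ε := by positivity
  have key : ∀ x, ‖1 / ε * sigmoid x‖ ≤ 1 / ε := fun x => by
    rw [Real.norm_of_nonneg (mul_nonneg he (Real.sigmoid_nonneg x))]
    exact mul_le_of_le_one_right he (Real.sigmoid_le_one x)
  exact max_le (key _) (key _)

namespace IsTrajectory

variable {ε : ℝ} {R f s g r : ℝ → ℝ}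

lemma hasDerivWithinAt_planeField (h : IsTrajectory ε R f s) {t : ℝ} (ht : t ∈ Ico (0 : ℝ) 1) :
    HasDerivWithinAt (fun t => (f t, s t + R t)) (planeField ε R t (f t, s t + R t)) (Ici t) t := by
  have hev : Icc (0 : ℝ) 1 ∈ 𝓝[Ici t] t :=
    mem_of_superset (Icc_mem_nhdsGE ht.2) (Icc_subset_Icc_left ht.1)
  have ht' : t ∈ Icc (0 : ℝ) 1 := Ico_subset_Icc_self ht
  have h1 := (hasDerivAt_add_mul_integral h.continuous_sigmoid_snd (f 0) (1 / ε) t)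
  have h2 := (hasDerivAt_add_mul_integral h.continuous_sigmoid_neg_fst (s 0) (1 / ε) t)
  have h3 := (h1.prodMk h2).hasDerivWithinAt (s := Ici t)
  simp only [planeField, add_sub_cancel_right]
  refine h3.congr_of_eventuallyEq ?_ ?_
  · filter_upwards [hev] with x hx
    rw [h.fst_eq x hx, h.snd_eq x hx, sub_add_cancel]
  · rw [← h.fst_eq t ht', h.snd_eq t ht', sub_add_cancel]

/-- Lipschitz dependence of a trajectory on its initial data. -/
lemma abs_sub_le (hf : IsTrajectory ε R f s) (hg : IsTrajectory ε R g r) (hε : 0 < ε)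
    (hR : Continuous R) (h0 : f 0 = g 0) {t : ℝ} (ht : t ∈ Icc (0 : ℝ) 1) :
    |f t - g t| ≤ |s 0 - r 0| * Real.exp (1 / ε * t) := by
  have h := dist_le_of_trajectories_ODE (δ := |s 0 - r 0|) (lipschitzWith_planeField hε R)
    (hf.continuous_fst.prodMk (hf.continuous_snd.add hR)).continuousOn
    (fun t ht => hf.hasDerivWithinAt_planeField ht)
    (hg.continuous_fst.prodMk (hg.continuous_snd.add hR)).continuousOn
    (fun t ht => hg.hasDerivWithinAt_planeField ht) (by simp [Prod.dist_eq, h0, Real.dist_eq]) t ht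
  rw [Real.coe_toNNReal _ (by positivity), sub_zero] at h
  exact (le_max_left _ _).trans h

end IsTrajectory

lemma eq_add_integral_of_hasDerivWithinAt {u v : ℝ → ℝ}
    (hv : ContinuousOn v (Icc 0 1))
    (h : ∀ t ∈ Icc (0 : ℝ) 1, HasDerivWithinAt u (v t) (Icc 0 1) t) {t : ℝ}
    (ht : t ∈ Icc (0 : ℝ) 1) : u t = u 0 + ∫ y in (0 : ℝ)..t, v y := by
  have hsub : Icc 0 t ⊆ Icc (0 : ℝ) 1 := Icc_subset_Icc_right ht.2
  rw [intervalIntegral.integral_eq_sub_of_hasDerivAt_of_le ht.1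
    (fun x hx => (h x (hsub hx)).continuousWithinAt.mono hsub)
    (fun x hx => (h x (hsub (Ioo_subset_Icc_self hx))).hasDerivAt
      (Icc_mem_nhds hx.1 (hx.2.trans_le ht.2)))
    ((hv.mono hsub).intervalIntegrable_of_Icc ht.1)]
  ring

lemma exists_isTrajectory {ε : ℝ} (hε : 0 < ε) {R : ℝ → ℝ} (hR : Continuous R) (hR0 : R 0 = 0)
    (x a : ℝ) : ∃ f s, IsTrajectory ε R f s ∧ f 0 = x ∧ s 0 = a := by
  have he : 0 ≤ 1 / ε := by positivity
  -- The field is bounded by `1/ε`, so in unit time the solution cannot leave the ball of radius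
  -- `1/ε`; a single Picard–Lindelöf step covers `[0,1]`.
  have hPL : IsPicardLindelof (planeField ε R) (tmin := 0) (tmax := 1)
      ⟨0, le_rfl, zero_le_one⟩ (x, a) (Real.toNNReal (1 / ε)) 0 (Real.toNNReal (1 / ε))
      (Real.toNNReal (1 / ε)) :=
    { lipschitzOnWith := fun t _ => (lipschitzWith_planeField hε R t).lipschitzOnWith
      continuousOn := fun p _ => by
        refine Continuous.continuousOn (Continuous.prodMk ?_ continuous_const)
        exact continuous_const.mul (continuous_sigmoid.comp (continuous_const.sub hR))
      norm_le := fun t _ p _ => by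
        rw [Real.coe_toNNReal _ he]
        exact norm_planeField_le hε R t p
      mul_max_le := by simp }
  obtain ⟨α, hα0, hα⟩ := hPL.exists_eq_forall_mem_Icc_hasDerivWithinAt₀
  have hαc : ContinuousOn α (Icc 0 1) := fun t ht => (hα t ht).continuousWithinAt
  have h1 : ∀ t ∈ Icc (0 : ℝ) 1, HasDerivWithinAt (fun t => (α t).1)
      (1 / ε * sigmoid ((α t).2 - R t)) (Icc 0 1) t := fun t ht =>
    (ContinuousLinearMap.fst ℝ ℝ ℝ).hasFDerivAt.comp_hasDerivWithinAt t (hα t ht)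
  have h2 : ∀ t ∈ Icc (0 : ℝ) 1, HasDerivWithinAt (fun t => (α t).2)
      (1 / ε * sigmoid (-(α t).1)) (Icc 0 1) t := fun t ht =>
    (ContinuousLinearMap.snd ℝ ℝ ℝ).hasFDerivAt.comp_hasDerivWithinAt t (hα t ht)
  set β : ℝ → ℝ × ℝ := IccExtend (zero_le_one (α := ℝ)) ((Icc (0 : ℝ) 1).domRestrict α) with hβ
  have hβc : Continuous β := (continuousOn_iff_continuous_domRestrict.1 hαc).Icc_extend'
  have hβe : ∀ t ∈ Icc (0 : ℝ) 1, β t = α t := fun t ht => IccExtend_of_mem _ _ ht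
  have h00 : (0 : ℝ) ∈ Icc (0 : ℝ) 1 := ⟨le_rfl, zero_le_one⟩
  refine ⟨fun t => (β t).1, fun t => (β t).2 - R t,
    ⟨hβc.fst, hβc.snd.sub hR, ?_, ?_⟩, ?_, ?_⟩
  · intro t ht
    have h := eq_add_integral_of_hasDerivWithinAt (by
      refine continuousOn_const.mul (continuous_sigmoid.comp_continuousOn ?_)
      exact (continuous_snd.comp_continuousOn hαc).sub hR.continuousOn) h1 ht
    simp only [hβe t ht, hβe 0 h00]
    rw [h, intervalIntegral.integral_const_mul]
    congr 2
    refine intervalIntegral.integral_congr fun y hy => ?_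
    rw [uIcc_of_le ht.1] at hy
    simp only [hβe y ⟨hy.1, hy.2.trans ht.2⟩]
  · intro t ht
    have h := eq_add_integral_of_hasDerivWithinAt (by
      refine continuousOn_const.mul (continuous_sigmoid.comp_continuousOn ?_)
      exact (continuous_fst.comp_continuousOn hαc).neg) h2 ht
    simp only [hβe t ht, hβe 0 h00, hR0, sub_zero]
    rw [h, intervalIntegral.integral_const_mul]
    congr 3
    refine intervalIntegral.integral_congr fun y hy => ?_
    rw [uIcc_of_le ht.1] at hy
    simp only [hβe y ⟨hy.1, hy.2.trans ht.2⟩]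
  · simp only [hβe 0 h00]
    simpa using congrArg Prod.fst hα0
  · simp only [hβe 0 h00, hR0, sub_zero]
    simpa using congrArg Prod.snd hα0

/-- Existence for the boundary value problem, by shooting. -/
lemma exists_isTrajectory_boundary {ε : ℝ} (hε : 0 < ε) {R : ℝ → ℝ} (hR : Continuous R)
    (hR0 : R 0 = 0) {x y : ℝ} (hxy : x < y) (hlt : y - x < 1 / ε) :
    ∃ f s, IsTrajectory ε R f s ∧ f 0 = x ∧ f 1 = y := by
  choose f s hT hf0 hs0 using exists_isTrajectory hε hR hR0 x
  have he : 0 < 1 / ε := by positivity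
  have h11 : (1 : ℝ) ∈ Icc (0 : ℝ) 1 := ⟨zero_le_one, le_rfl⟩
  have hlip : LipschitzWith (Real.toNNReal (Real.exp (1 / ε))) fun a => f a 1 := by
    refine LipschitzWith.of_dist_le_mul fun a b => ?_
    have := (hT a).abs_sub_le (hT b) hε hR ((hf0 a).trans (hf0 b).symm) h11
    rw [hs0, hs0, mul_one, mul_comm] at this
    rwa [Real.coe_toNNReal _ (Real.exp_pos _).le, Real.dist_eq, Real.dist_eq]
  obtain ⟨C, hC⟩ := isCompact_Icc.exists_bound_of_continuousOn (s := Icc (0 : ℝ) 1)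
    hR.continuousOn
  have hbd : ∀ a, ∀ t ∈ Icc (0 : ℝ) 1, a - C ≤ s a t ∧ s a t ≤ a + (1 / ε + C) := by
    intro a t ht
    have h := (hT a).snd_eq t ht
    rw [hs0] at h
    have hRt := abs_le.1 (hC t ht)
    have hi0 : 0 ≤ ∫ y in (0 : ℝ)..t, sigmoid (-f a y) :=
      intervalIntegral.integral_nonneg ht.1 fun _ _ => Real.sigmoid_nonneg _
    have hi1 : ∫ y in (0 : ℝ)..t, sigmoid (-f a y) ≤ 1 := by
      have : ∫ y in (0 : ℝ)..t, sigmoid (-f a y) ≤ ∫ y in (0 : ℝ)..t, (1 : ℝ) :=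
        intervalIntegral.integral_mono_on ht.1
          ((hT a).continuous_sigmoid_neg_fst.intervalIntegrable _ _) (by simp)
          fun _ _ => Real.sigmoid_le_one _
      refine this.trans ?_
      simpa using ht.2
    constructor <;> nlinarith [hRt.1, hRt.2, mul_le_mul_of_nonneg_left hi1 he.le,
      mul_nonneg he.le hi0]
  have hend : ∀ a, f a 1 = x + 1 / ε * ∫ y in (0 : ℝ)..1, sigmoid (s a y) := fun a => by
    rw [(hT a).fst_eq 1 h11, hf0]
  set θ := ε * (y - x) with hθ
  have hθ0 : 0 < θ := mul_pos hε (by linarith)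
  have hθ1 : θ < 1 := by rw [lt_div_iff₀ hε] at hlt; linarith
  have hyθ : y = x + 1 / ε * θ := by rw [hθ]; field_simp; ring
  obtain ⟨p, hp⟩ : ∃ p, sigmoid p = θ := by
    have : θ ∈ range sigmoid := by rw [Real.range_sigmoid]; exact ⟨hθ0, hθ1⟩
    exact this
  -- With this initial value `s ≤ p` on all of `[0,1]`, so the mean of `σ(s)` is at most `θ`;
  -- starting from `p + C` gives `s ≥ p` instead.
  have hlow : f (p - (1 / ε + C)) 1 ≤ y := by
    rw [hend, hyθ]
    gcongr
    have : ∫ y in (0 : ℝ)..1, sigmoid (s (p - (1 / ε + C)) y) ≤ ∫ y in (0 : ℝ)..1, θ :=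
      intervalIntegral.integral_mono_on zero_le_one
        ((hT _).continuous_sigmoid_snd.intervalIntegrable _ _) (by simp) fun t ht => by
          rw [← hp]
          exact Real.sigmoid_monotone (by linarith [(hbd (p - (1 / ε + C)) t ht).2])
    simpa using this
  have hhigh : y ≤ f (p + C) 1 := by
    rw [hend, hyθ]
    gcongr
    have : ∫ y in (0 : ℝ)..1, θ ≤ ∫ y in (0 : ℝ)..1, sigmoid (s (p + C) y) :=
      intervalIntegral.integral_mono_on zero_le_one (by simp)
        ((hT _).continuous_sigmoid_snd.intervalIntegrable _ _) fun t ht => by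
          rw [← hp]
          exact Real.sigmoid_monotone (by linarith [(hbd (p + C) t ht).1])
    simpa using this
  obtain ⟨a, ha⟩ := mem_range_of_exists_le_of_exists_ge hlip.continuous ⟨_, hlow⟩ ⟨_, hhigh⟩
  exact ⟨f a, s a, hT a, hf0 a, ha⟩

/-! ### Critical points as trajectories -/

/-- The function `t ↦ ε⁻¹ ∫₀^t ρ`, extended from `[0,1]` to the line by constants. -/
def cumul (ε : ℝ) (ρ : Lp ℝ ∞ lebUnit) : ℝ → ℝ :=
  IccExtend (zero_le_one (α := ℝ)) fun x : I => 1 / ε * ∫ z in (0 : ℝ)..x, ρ z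

lemma integrableOn_coe (ρ : Lp ℝ ∞ lebUnit) : IntegrableOn (fun z => ρ z) (Icc 0 1) volume :=
  (Lp.memLp ρ).integrable le_top

lemma intervalIntegrable_coe (ρ : Lp ℝ ∞ lebUnit) {t : ℝ} (ht : t ∈ Icc (0 : ℝ) 1) :
    IntervalIntegrable (fun z => ρ z) volume 0 t :=
  (intervalIntegrable_iff_integrableOn_Icc_of_le ht.1).2
    ((integrableOn_coe ρ).mono_set (Icc_subset_Icc_right ht.2))

lemma continuous_IccExtend_integral {g : ℝ → ℝ} (hg : IntegrableOn g (Icc 0 1) volume) :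
    Continuous (IccExtend (zero_le_one (α := ℝ)) fun x : I => ∫ z in (0 : ℝ)..x, g z) := by
  have hc := intervalIntegral.continuousOn_primitive_interval (a := (0 : ℝ)) (b := 1)
    (f := g) (μ := volume) (by rwa [uIcc_of_le zero_le_one])
  rw [uIcc_of_le zero_le_one] at hc
  exact (continuousOn_iff_continuous_domRestrict.1 hc).Icc_extend'

lemma continuous_cumul (ε : ℝ) (ρ : Lp ℝ ∞ lebUnit) : Continuous (cumul ε ρ) :=
  continuous_const.mul (continuous_IccExtend_integral (integrableOn_coe ρ))

lemma cumul_of_mem (ε : ℝ) (ρ : Lp ℝ ∞ lebUnit) {t : ℝ} (ht : t ∈ Icc (0 : ℝ) 1) :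
    cumul ε ρ t = 1 / ε * ∫ z in (0 : ℝ)..t, ρ z :=
  IccExtend_of_mem _ _ ht

lemma inv_one_add_exp_eq (x : ℝ) : (1 + Real.exp x)⁻¹ = sigmoid (-x) := by
  rw [Real.sigmoid_def, neg_neg]

lemma exp_div_one_add_exp_eq (x : ℝ) : Real.exp x / (1 + Real.exp x) = sigmoid x := by
  rw [Real.sigmoid_def, Real.exp_neg]
  field_simp
  ring

lemma preK_eq {ε φ₀ A : ℝ} {ρ : Lp ℝ ∞ lebUnit} {φ : I → ℝ} {s : ℝ → ℝ} (hA : 0 < A)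
    (hs : ∀ y ∈ Icc (0 : ℝ) 1, s y = Real.log A + 1 / ε * ∫ z in (0 : ℝ)..y,
      ((1 + Real.exp (IccExtend zero_le_one φ z))⁻¹ - ρ z)) (x : I) :
    preK ε φ₀ ρ φ A x = φ₀ + 1 / ε * ∫ y in (0 : ℝ)..x, sigmoid (s y) := by
  unfold preK
  congr 2
  refine intervalIntegral.integral_congr fun y hy => ?_
  rw [uIcc_of_le x.2.1] at hy
  have : A * weight ε ρ φ y = Real.exp (s y) := by
    rw [hs y ⟨hy.1, hy.2.trans x.2.2⟩, Real.exp_add, Real.exp_log hA, weight]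
  simp only [this, exp_div_one_add_exp_eq]

/-- The second component is `s = log A + ε⁻¹ ∫ (σ(-φ) - ρ)`. Extension by constants supplies the
continuity on the whole line that `IsTrajectory` asks for. -/
lemma exists_isTrajectory_of_mem_P {ε φ₀ φ₁ : ℝ} (hφ : φ₀ < φ₁) (hε : 0 < ε)
    (hε₀ : ε < eps0 φ₀ φ₁) {ρ : Lp ℝ ∞ lebUnit} {φ : I → ℝ} (h : φ ∈ P ε φ₀ φ₁ ρ) :
    ∃ f s, IsTrajectory ε (cumul ε ρ) f s ∧ f 0 = φ₀ ∧ f 1 = φ₁ ∧ ∀ x : I, φ x = f x := by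
  obtain ⟨hF, hK⟩ := h
  obtain ⟨hA, hA1⟩ : IsNormalizing ε φ₀ φ₁ ρ φ (normConst ε φ₀ φ₁ ρ φ) :=
    Classical.epsilon_spec (existsUnique_isNormalizing hφ hε hε₀ ρ hF).exists
  unfold K at hK
  set A := normConst ε φ₀ φ₁ ρ φ
  have hmon : Monotone (IccExtend (zero_le_one (α := ℝ)) φ) := (F_monotone hF).IccExtend _
  have hb : IntegrableOn (fun z : ℝ => (1 + Real.exp (IccExtend zero_le_one φ z))⁻¹)
      (Icc 0 1) volume := by
    refine Measure.integrableOn_of_bounded (M := 1) (by simp) (Measurable.aestronglyMeasurable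
      (measurable_const.add (Real.measurable_exp.comp hmon.measurable)).inv)
      (Eventually.of_forall fun z => ?_)
    rw [inv_one_add_exp_eq, Real.norm_of_nonneg (Real.sigmoid_nonneg _)]
    exact Real.sigmoid_le_one _
  set J : ℝ → ℝ := IccExtend (zero_le_one (α := ℝ)) fun x : I =>
    ∫ z in (0 : ℝ)..x, ((1 + Real.exp (IccExtend zero_le_one φ z))⁻¹ - ρ z) with hJ
  have hJc : Continuous J := continuous_IccExtend_integral (hb.sub (integrableOn_coe ρ))
  have hJe : ∀ t ∈ Icc (0 : ℝ) 1, J t = ∫ z in (0 : ℝ)..t,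
      ((1 + Real.exp (IccExtend zero_le_one φ z))⁻¹ - ρ z) := fun t ht =>
    IccExtend_of_mem _ _ ht
  set s : ℝ → ℝ := fun t => Real.log A + 1 / ε * J t with hs
  have hsc : Continuous s := continuous_const.add (continuous_const.mul hJc)
  have hφe : ∀ x : I, φ x = φ₀ + 1 / ε * ∫ y in (0 : ℝ)..x, sigmoid (s y) := fun x => by
    rw [← preK_eq hA (fun y hy => by rw [hs, ← hJe y hy]) x, hK]
  have h00 : (0 : ℝ) ∈ Icc (0 : ℝ) 1 := ⟨le_rfl, zero_le_one⟩
  have h11 : (1 : ℝ) ∈ Icc (0 : ℝ) 1 := ⟨zero_le_one, le_rfl⟩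
  have hext : ∀ t (ht : t ∈ Icc (0 : ℝ) 1), IccExtend (zero_le_one (α := ℝ)) φ t = φ ⟨t, ht⟩ :=
    fun t ht => IccExtend_of_mem _ _ ht
  have hf0 : IccExtend (zero_le_one (α := ℝ)) φ 0 = φ₀ := by
    rw [hext 0 h00, hφe]; simp
  refine ⟨IccExtend zero_le_one φ, s, ⟨?_, hsc, ?_, ?_⟩, hf0, ?_, ?_⟩
  · have hi : Continuous fun t => φ₀ + 1 / ε * ∫ y in (0 : ℝ)..t, sigmoid (s y) :=
      continuous_iff_continuousAt.2 fun t =>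
        (hasDerivAt_add_mul_integral (continuous_sigmoid.comp hsc) φ₀ (1 / ε) t).continuousAt
    have : φ = fun x : I => φ₀ + 1 / ε * ∫ y in (0 : ℝ)..x, sigmoid (s y) := funext hφe
    refine Continuous.Icc_extend' ?_
    rw [this]
    exact hi.comp continuous_subtype_val
  · intro t ht
    rw [hf0, hext t ht, hφe]
  · intro t ht
    have e0 : J 0 = 0 := by rw [hJe 0 h00, intervalIntegral.integral_same]
    have hbi : IntervalIntegrable (fun z : ℝ => (1 + Real.exp (IccExtend zero_le_one φ z))⁻¹)
        volume 0 t := (intervalIntegrable_iff_integrableOn_Icc_of_le ht.1).2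
      (hb.mono_set (Icc_subset_Icc_right ht.2))
    simp only [hs, e0]
    rw [hJe t ht, cumul_of_mem ε ρ ht, intervalIntegral.integral_sub hbi
      (intervalIntegrable_coe ρ ht)]
    simp only [inv_one_add_exp_eq]
    ring
  · rw [hext 1 h11, ← hA1, hK]; rfl
  · intro x
    rw [hext x x.2]

lemma mem_F_of_eq_integral {φ₀ φ₁ : ℝ} {g : ℝ → ℝ} (hg : Continuous g) (hg0 : ∀ t, 0 ≤ g t)
    {φ : I → ℝ} (hφ : ∀ x : I, φ x = φ₀ + ∫ y in (0 : ℝ)..x, g y) (h1 : φ 1 = φ₁) :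
    φ ∈ F φ₀ φ₁ := by
  have hpm : Measurable (projIcc (0 : ℝ) 1 zero_le_one) := continuous_projIcc.measurable
  -- The measure required by `F` is the one with density `g`, pushed to `I` by the projection.
  set ν : Measure ℝ := (volume.restrict (Ioc 0 1)).withDensity fun t => ENNReal.ofReal (g t)
    with hν
  have hIoc : ∀ x ∈ Icc (0 : ℝ) 1, ν (Ioc 0 x) = ENNReal.ofReal (∫ y in (0 : ℝ)..x, g y) := by
    intro x hx
    rw [hν, withDensity_apply _ measurableSet_Ioc,
      Measure.restrict_restrict measurableSet_Ioc,
      inter_eq_left.2 (Ioc_subset_Ioc_right hx.2), intervalIntegral.integral_of_le hx.1,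
      ofReal_integral_eq_lintegral_ofReal ((hg.intervalIntegrable 0 x).1)
        (Eventually.of_forall hg0)]
  have hout : ν (Ioc 0 1)ᶜ = 0 := by
    rw [hν, withDensity_apply _ measurableSet_Ioc.compl,
      Measure.restrict_restrict measurableSet_Ioc.compl, compl_inter_self]
    simp
  have hmap : ∀ x : I, (ν.map (projIcc (0 : ℝ) 1 zero_le_one)) (Iic x)
      = ENNReal.ofReal (∫ y in (0 : ℝ)..x, g y) := by
    intro x
    rw [Measure.map_apply hpm measurableSet_Iic, ← hIoc x x.2,
      ← measure_inter_add_sdiff _ (measurableSet_Ioc (a := (0 : ℝ)) (b := 1))]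
    have : ν (projIcc (0 : ℝ) 1 zero_le_one ⁻¹' Iic x \ Ioc 0 1) = 0 :=
      measure_mono_null (fun t ht => ht.2) hout
    rw [this, add_zero]
    congr 1
    ext t
    simp only [mem_inter_iff, mem_preimage, mem_Iic, mem_Ioc]
    constructor
    · rintro ⟨h, ht⟩
      rw [projIcc_of_mem _ ⟨ht.1.le, ht.2⟩] at h
      exact ⟨ht.1, h⟩
    · rintro ⟨h0, h⟩
      have ht1 : t ≤ 1 := h.trans x.2.2
      rw [projIcc_of_mem _ ⟨h0.le, ht1⟩]
      exact ⟨h, h0, ht1⟩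
  have hi0 : ∀ x : I, 0 ≤ ∫ y in (0 : ℝ)..x, g y := fun x =>
    intervalIntegral.integral_nonneg x.2.1 fun y _ => hg0 y
  refine ⟨ν.map (projIcc (0 : ℝ) 1 zero_le_one), ?_, fun x => ?_⟩
  · have : (univ : Set I) = Iic 1 := by
      ext x; simpa using unitInterval.le_one'
    rw [this, hmap, ← h1, hφ, add_sub_cancel_left]
  · rw [hmap, ENNReal.toReal_ofReal (hi0 x), hφ]

/-- The constant `e^{s 0}` is normalizing because `f 1 = φ₁`; uniqueness of the normalizing constant
identifies it with `normConst`. -/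
lemma IsTrajectory.mem_P {ε φ₀ φ₁ : ℝ} (hφ : φ₀ < φ₁) (hε : 0 < ε)
    (hε₀ : ε < eps0 φ₀ φ₁) {ρ : Lp ℝ ∞ lebUnit} {f s : ℝ → ℝ}
    (h : IsTrajectory ε (cumul ε ρ) f s) (h0 : f 0 = φ₀) (h1 : f 1 = φ₁) :
    (fun x : I => f x) ∈ P ε φ₀ φ₁ ρ := by
  have hfe : ∀ x : I, f x = φ₀ + 1 / ε * ∫ y in (0 : ℝ)..x, sigmoid (s y) := fun x => by
    rw [h.fst_eq x x.2, h0]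
  have hF : (fun x : I => f x) ∈ F φ₀ φ₁ := by
    refine mem_F_of_eq_integral (g := fun y => 1 / ε * sigmoid (s y))
      (continuous_const.mul h.continuous_sigmoid_snd)
      (fun t => mul_nonneg (by positivity) (Real.sigmoid_nonneg _)) (fun x => ?_)
      (by simpa using h1)
    rw [hfe, intervalIntegral.integral_const_mul]
  have hpre : preK ε φ₀ ρ (fun x : I => f x) (Real.exp (s 0)) = fun x : I => f x := by
    funext x
    rw [hfe]
    refine preK_eq (Real.exp_pos _) (fun y hy => ?_) x
    have hc : ∫ z in (0 : ℝ)..y,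
        ((1 + Real.exp (IccExtend zero_le_one (fun x : I => f x) z))⁻¹ - ρ z)
        = ∫ z in (0 : ℝ)..y, (sigmoid (-f z) - ρ z) := by
      refine intervalIntegral.integral_congr fun z hz => ?_
      rw [uIcc_of_le hy.1] at hz
      simp only [inv_one_add_exp_eq]
      rw [IccExtend_of_mem _ _ ⟨hz.1, hz.2.trans hy.2⟩]
    rw [hc, intervalIntegral.integral_sub (h.continuous_sigmoid_neg_fst.intervalIntegrable _ _)
      (intervalIntegrable_coe ρ hy), Real.log_exp, h.snd_eq y hy, cumul_of_mem ε ρ hy]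
    ring
  have hnorm : IsNormalizing ε φ₀ φ₁ ρ (fun x : I => f x) (Real.exp (s 0)) :=
    ⟨Real.exp_pos _, by rw [hpre]; simpa using h1⟩
  have hex := existsUnique_isNormalizing hφ hε hε₀ ρ hF
  have hA : normConst ε φ₀ φ₁ ρ (fun x : I => f x) = Real.exp (s 0) :=
    hex.unique (Classical.epsilon_spec hex.exists) hnorm
  exact ⟨hF, by rw [K, hA, hpre]⟩

/-- The set of critical points is a singleton as soon as trajectories are determined by the
boundary values of their first component. -/
lemma exists_P_eq_singleton {ε φ₀ φ₁ : ℝ} (hφ : φ₀ < φ₁) (hε : 0 < ε) (hε₀ : ε < eps0 φ₀ φ₁)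
    (ρ : Lp ℝ ∞ lebUnit)
    (huniq : ∀ f s g r, IsTrajectory ε (cumul ε ρ) f s → IsTrajectory ε (cumul ε ρ) g r →
      f 0 = φ₀ → g 0 = φ₀ → f 1 = φ₁ → g 1 = φ₁ → EqOn f g (Icc 0 1)) :
    ∃ φ, P ε φ₀ φ₁ ρ = {φ} := by
  have hd : 0 < φ₁ - φ₀ := by linarith
  have hlt : φ₁ - φ₀ < 1 / ε := by
    rw [eps0, lt_div_iff₀ hd] at hε₀
    rw [lt_div_iff₀ hε]; linarith
  obtain ⟨f, s, hT, h0, h1⟩ := exists_isTrajectory_boundary hε (continuous_cumul ε ρ)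
    (by rw [cumul_of_mem ε ρ ⟨le_rfl, zero_le_one⟩]; simp) hφ hlt
  refine ⟨fun x : I => f x, Subset.antisymm (fun ψ hψ => ?_)
    (singleton_subset_iff.2 (hT.mem_P hφ hε hε₀ h0 h1))⟩
  obtain ⟨g, r, hT', h0', h1', hψe⟩ := exists_isTrajectory_of_mem_P hφ hε hε₀ hψ
  funext x
  rw [hψe x]
  exact huniq g r f s hT' hT h0' h0 h1' h1 x.2

/-! ### The three uniqueness regimes -/

lemma IsTrajectory.integral_sigmoid_snd {ε : ℝ} {R f s : ℝ → ℝ} (h : IsTrajectory ε R f s)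
    (hε : 0 < ε) : ∫ y in (0 : ℝ)..1, sigmoid (s y) = ε * (f 1 - f 0) := by
  rw [h.fst_eq 1 ⟨zero_le_one, le_rfl⟩]
  field_simp
  ring

/-- Here `∫ c = 2 ε (φ₁ - φ₀)`, and the hypothesis says that this is less than `ε²`. -/
lemma exists_P_eq_singleton_of_sub_lt {ε φ₀ φ₁ : ℝ} (hφ : φ₀ < φ₁) (hε : 0 < ε)
    (hε₀ : ε < eps0 φ₀ φ₁) (hlt : 2 * (φ₁ - φ₀) < ε) (ρ : Lp ℝ ∞ lebUnit) :
    ∃ φ, P ε φ₀ φ₁ ρ = {φ} := by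
  refine exists_P_eq_singleton hφ hε hε₀ ρ fun f s g r hf hg f0 g0 f1 g1 => ?_
  refine hf.eqOn_of_integral_lt hg hε (f0.trans g0.symm) (f1.trans g1.symm)
    (c := fun t => sigmoid (s t) + sigmoid (r t))
    (hf.continuous_sigmoid_snd.add hg.continuous_sigmoid_snd)
    (fun t => (abs_sigmoid_sub_le _ _).1)
    (fun t => add_nonneg (Real.sigmoid_nonneg _) (Real.sigmoid_nonneg _)) ?_
  rw [intervalIntegral.integral_add (hf.continuous_sigmoid_snd.intervalIntegrable _ _)
    (hg.continuous_sigmoid_snd.intervalIntegrable _ _), hf.integral_sigmoid_snd hε,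
    hg.integral_sigmoid_snd hε, f0, f1, g0, g1]
  nlinarith

/-- The weight `(1 - σ(s)) + (1 - σ(r))` has integral `2 (1 - ε (φ₁ - φ₀))`, which vanishes as `ε →
ε₀`. -/
lemma exists_P_eq_singleton_of_lt_sq {ε φ₀ φ₁ : ℝ} (hφ : φ₀ < φ₁) (hε : 0 < ε)
    (hε₀ : ε < eps0 φ₀ φ₁) (hlt : 2 * (1 - ε * (φ₁ - φ₀)) < ε ^ 2) (ρ : Lp ℝ ∞ lebUnit) :
    ∃ φ, P ε φ₀ φ₁ ρ = {φ} := by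
  refine exists_P_eq_singleton hφ hε hε₀ ρ fun f s g r hf hg f0 g0 f1 g1 => ?_
  have hcf := hf.continuous_sigmoid_snd
  have hcg := hg.continuous_sigmoid_snd
  refine hf.eqOn_of_integral_lt hg hε (f0.trans g0.symm) (f1.trans g1.symm)
    (c := fun t => 2 - sigmoid (s t) - sigmoid (r t)) (by fun_prop)
    (fun t => (abs_sigmoid_sub_le _ _).2)
    (fun t => by linarith [Real.sigmoid_le_one (s t), Real.sigmoid_le_one (r t)]) ?_
  rw [intervalIntegral.integral_sub (Continuous.intervalIntegrable (by fun_prop) _ _)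
    (hcg.intervalIntegrable _ _), intervalIntegral.integral_sub (by simp)
    (hcf.intervalIntegrable _ _), hf.integral_sigmoid_snd hε,
    hg.integral_sigmoid_snd hε, f0, f1, g0, g1]
  simp only [intervalIntegral.integral_const, sub_zero, one_smul]
  linarith

lemma hasDerivAt_cumul {ε : ℝ} {ρ : Lp ℝ ∞ lebUnit} {w : ℝ → ℝ} (hw : ContinuousOn w (Icc 0 1))
    (hρ : ρ =ᵐ[lebUnit] w) {t : ℝ} (ht : t ∈ Ioo (0 : ℝ) 1) :
    HasDerivAt (cumul ε ρ) (1 / ε * w t) t := by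
  set v : ℝ → ℝ := IccExtend (zero_le_one (α := ℝ)) ((Icc (0 : ℝ) 1).domRestrict w) with hv
  have hvc : Continuous v := (continuousOn_iff_continuous_domRestrict.1 hw).Icc_extend'
  have hve : ∀ t ∈ Icc (0 : ℝ) 1, v t = w t := fun t ht => IccExtend_of_mem _ _ ht
  have h := hasDerivAt_add_mul_integral hvc 0 (1 / ε) t
  rw [hve t (Ioo_subset_Icc_self ht)] at h
  refine h.congr_of_eventuallyEq ?_
  filter_upwards [Icc_mem_nhds ht.1 ht.2] with x hx
  rw [cumul_of_mem ε ρ hx, zero_add]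
  congr 1
  refine intervalIntegral.integral_congr_ae ?_
  have h2 := (ae_restrict_iff' measurableSet_Icc).1 hρ
  filter_upwards [h2] with z hz hzx
  rw [uIoc_of_le hx.1] at hzx
  have hz' : z ∈ Icc (0 : ℝ) 1 := ⟨hzx.1.le, hzx.2.trans hx.2⟩
  rw [hz hz', hve z hz']

lemma exists_P_eq_singleton_of_isC1StrictIncreasing {ε φ₀ φ₁ : ℝ} (hφ : φ₀ < φ₁) (hε : 0 < ε)
    (hε₀ : ε < eps0 φ₀ φ₁) {ρ : Lp ℝ ∞ lebUnit} (hρ : IsC1StrictIncreasing ρ) :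
    ∃ φ, P ε φ₀ φ₁ ρ = {φ} := by
  obtain ⟨w, hw, hmono, hae⟩ := hρ
  have hder : ∀ t ∈ Ioo (0 : ℝ) 1, HasDerivAt w (derivWithin w (Icc 0 1) t) t := fun t ht =>
    ((hw.differentiableOn one_ne_zero t (Ioo_subset_Icc_self ht)).hasDerivWithinAt).hasDerivAt
      (Icc_mem_nhds ht.1 ht.2)
  have hne : ∀ f s g r, IsTrajectory ε (cumul ε ρ) f s → IsTrajectory ε (cumul ε ρ) g r →
      f 0 = g 0 → r 0 < s 0 → f 1 ≠ g 1 := fun f s g r hf hg h0 hlt =>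
    hf.fst_one_ne hg hε hw.continuousOn (fun t ht => hasDerivAt_cumul hw.continuousOn hae ht)
      hder (fun t _ => hmono.monotoneOn.derivWithin_nonneg) h0 hlt
  refine exists_P_eq_singleton hφ hε hε₀ ρ fun f s g r hf hg f0 g0 f1 g1 => ?_
  have h0 : f 0 = g 0 := f0.trans g0.symm
  have h1 : f 1 = g 1 := f1.trans g1.symm
  -- Unequal initial `s` contradict the common end value by the energy argument; equal ones give the
  -- same initial data, hence the same trajectory.
  rcases lt_trichotomy (r 0) (s 0) with h | h | h
  · exact absurd h1 (hne f s g r hf hg h0 h)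
  · intro t ht
    have := hf.abs_sub_le hg hε (continuous_cumul ε ρ) h0 ht
    rw [h, sub_self, abs_zero, zero_mul, abs_nonpos_iff] at this
    exact sub_eq_zero.1 this
  · exact absurd h1.symm (hne g r f s hg hf h0.symm h)

end BurgersStatic

end

theorem theorem2p4 :
    (∀ φ₀ φ₁ : ℝ, φ₀ < φ₁ →
      ∃ ε₁ ∈ Set.Ioo 0 (BurgersStatic.eps0 φ₀ φ₁),
        ∀ ε ∈ Set.Ioo ε₁ (BurgersStatic.eps0 φ₀ φ₁), ∀ ρ ∈ BurgersStatic.M,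
          ∃ φ, BurgersStatic.P ε φ₀ φ₁ ρ = {φ}) ∧
    (∀ ε : ℝ, 0 < ε →
      ∃ δ ∈ Set.Ioo 0 ε⁻¹,
        ∀ φ₀ φ₁ : ℝ, 0 < φ₁ - φ₀ → φ₁ - φ₀ < δ → ∀ ρ ∈ BurgersStatic.M,
          ∃ φ, BurgersStatic.P ε φ₀ φ₁ ρ = {φ}) ∧
    (∀ φ₀ φ₁ : ℝ, φ₀ < φ₁ → ∀ ε ∈ Set.Ioo 0 (BurgersStatic.eps0 φ₀ φ₁),
      ∀ ρ ∈ BurgersStatic.M, BurgersStatic.IsC1StrictIncreasing ρ →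
        ∃ φ, BurgersStatic.P ε φ₀ φ₁ ρ = {φ}) := by
  refine ⟨fun φ₀ φ₁ hφ => ?_, fun ε hε => ?_, fun φ₀ φ₁ hφ ε hε ρ _ hC =>
    BurgersStatic.exists_P_eq_singleton_of_isC1StrictIncreasing hφ hε.1 hε.2 hC⟩
  · have hd : 0 < φ₁ - φ₀ := by linarith
    have he : 0 < BurgersStatic.eps0 φ₀ φ₁ := one_div_pos.2 hd
    have hed : BurgersStatic.eps0 φ₀ φ₁ * (φ₁ - φ₀) = 1 := one_div_mul_cancel hd.ne'
    set e := BurgersStatic.eps0 φ₀ φ₁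
    set d := φ₁ - φ₀
    -- As `e d = 1`, the second bound gives `2 (1 - ε d) = 2 (e - ε) d < e²/4`, and the first gives
    -- `e²/4 < ε²`.
    refine ⟨max (e / 2) (e - e ^ 3 / 8), ⟨lt_max_of_lt_left (by positivity),
      max_lt (by linarith) (by linarith [pow_pos he 3])⟩, fun ε hε ρ _ => ?_⟩
    have h1 : e / 2 < ε := (le_max_left _ _).trans_lt hε.1
    have h2 : e - e ^ 3 / 8 < ε := (le_max_right _ _).trans_lt hε.1
    refine BurgersStatic.exists_P_eq_singleton_of_lt_sq hφ (by linarith) hε.2 ?_ ρ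
    have h3 : (e - ε) * d < e ^ 3 / 8 * d := mul_lt_mul_of_pos_right (by linarith) hd
    have h4 : e ^ 3 / 8 * d = e ^ 2 / 8 := by linear_combination e ^ 2 / 8 * hed
    have h5 : e ^ 2 / 4 < ε ^ 2 := by nlinarith
    change 2 * (1 - ε * d) < ε ^ 2
    linarith
  -- `ε / 2` is the contraction threshold; `ε⁻¹ / 2` keeps `δ` below `ε⁻¹`, so that `ε < ε₀`.
  · refine ⟨min (ε / 2) (ε⁻¹ / 2), ⟨lt_min (by positivity) (by positivity),
      (min_le_right _ _).trans_lt (half_lt_self (by positivity))⟩, fun φ₀ φ₁ hd hlt ρ _ => ?_⟩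
    have h1 : φ₁ - φ₀ < ε / 2 := hlt.trans_le (min_le_left _ _)
    have h2 : φ₁ - φ₀ < ε⁻¹ := (hlt.trans_le (min_le_right _ _)).trans
      (half_lt_self (by positivity))
    refine BurgersStatic.exists_P_eq_singleton_of_sub_lt (by linarith) hε ?_ (by linarith) ρ
    rw [BurgersStatic.eps0, lt_one_div hε hd, one_div]
    exact h2
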